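/- Write $o$ for the origin of $\mathbb{R}^2$. For a compact convex set $L\subset\mathbb{R}^2$ with $o$ in its interior, let $\lambda_1(L)=\min\{t\ge 0 : tL\cap\mathbb{Z}^2\neq\{o\}\}$ be its first successive minimum with respect to the integer lattice, and let $L^*=\{y\in\mathbb{R}^2 : \langle x,y\rangle\le 1 \text{ for all } x\in L\}$ be its polar. Let $K\subset\mathbb{R}^2$ be an origin-symmetric (that is, $-K=K$) compact convex set with $o\in\operatorname{int}(K)$. Then $$\lambda_1(K)\,\lambda_1(K^*)\le \tfrac43 .$$ Moreover, equality holds if and only if $$K=\lambda\, U\cdot\operatorname{conv}\{\pm(2,1),\ \pm(1,2),\ \pm(-1,1)\}$$ for some real $\lambda>0$ and some $U\in\mathrm{GL}_2(\mathbb{Z})$, that is, some integer $2\times 2$ matrix $U$ whose inverse exists and is an integer matrix. -/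

import Mathlib

open scoped Pointwise MatrixGroups

noncomputable section

/-- The integer lattice `ℤ^d` as a subset of `ℝ^d`. -/
def integerLattice (d : ℕ) : Set (EuclideanSpace ℝ (Fin d)) :=
  {x | ∀ i, ∃ n : ℤ, x i = n}

/-- The polar set `X* = {y | ⟨x, y⟩ ≤ 1 for all x ∈ X}`. -/
def polarSet {d : ℕ} (X : Set (EuclideanSpace ℝ (Fin d))) : Set (EuclideanSpace ℝ (Fin d)) :=
  {y | ∀ x ∈ X, inner ℝ x y ≤ 1}

/-- The first successive minimum
`λ₁(K) = min {t ≥ 0 | tK ∩ ℤ^d ≠ {0}}`. For a compact convex `K` with the origin in its interior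
the minimum is attained, and so it is the infimum of this (nonempty) set. -/
def firstMinimum {d : ℕ} (K : Set (EuclideanSpace ℝ (Fin d))) : ℝ :=
  sInf {t : ℝ | 0 ≤ t ∧ (t • K) ∩ integerLattice d ≠ {0}}

/-- The linear image `U · X` of a subset of `ℝ^d` under a matrix `U ∈ GL_d(ℤ)`. -/
def unimodularImage {d : ℕ} (U : GL (Fin d) ℤ) (X : Set (EuclideanSpace ℝ (Fin d))) :
    Set (EuclideanSpace ℝ (Fin d)) :=
  Matrix.toEuclideanLin ((U : Matrix (Fin d) (Fin d) ℤ).map (fun n : ℤ => (n : ℝ))) '' X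

/-- The hexagon `conv {±(2,1), ±(1,2), ±(-1,1)}`. -/
def extremalHexagon : Set (EuclideanSpace ℝ (Fin 2)) :=
  convexHull ℝ {!₂[2, 1], -!₂[2, 1], !₂[1, 2], -!₂[1, 2], !₂[-1, 1], -!₂[-1, 1]}

end

/-! `λ₁(K*)` is the least value of the support function of `K` at nonzero integer vectors. A
unimodular map taking a shortest lattice vector to (1,0), together with scaling, turns `K` into a
body `S` with first minimum 1, on which every nonzero integer functional attains `t = λ₁(K) λ₁(K*)`.
Assume `t ≥ 4/3`.

After a shear, `S` contains `P = (a,t)`, `Q = (t,b)`, `R = (c,c-t)` with `a, b, c` in `(0,t)`. The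
lattice points (1,1), (1,0), (0,1) lie in the cones over `P,Q`, over `Q,R` and over `P,-R`. None is
interior to `S`, so each has coefficient sum at least 1 (`one_le_add`). This gives three bounds of
the form `(t-1)² ≤ xy`, and by AM-GM their sum forces `t ≤ 4/3` (`eq_of_four_thirds_le`).

At `t = 4/3` the points are determined, and the three lattice points become edge midpoints of the
hexagon on `±P, ±Q, ±R`. Convexity then prevents `S` from passing any edge, so `S` is that hexagon.
The converse bounds both minima of the hexagon below by integrality. -/

/-! ### Convex combinations and hexagons -/

/-- A convex set containing `0` is closed under combinations of total weight at most one. -/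
theorem Convex.add_smul_mem_of_add_le_one {E : Type*} [AddCommGroup E] [Module ℝ E] {S : Set E}
    (hS : Convex ℝ S) (h0 : (0 : E) ∈ S) {P Q : E} (hP : P ∈ S) (hQ : Q ∈ S) {u v : ℝ}
    (hu : 0 ≤ u) (hv : 0 ≤ v) (huv : u + v ≤ 1) : u • P + v • Q ∈ S := by
  rcases (add_nonneg hu hv).eq_or_lt with h | h
  · have h1 : u = 0 := by linarith
    have h2 : v = 0 := by linarith
    simpa [h1, h2] using h0
  · have h3 := hS hP hQ (div_nonneg hu h.le) (div_nonneg hv h.le) (by field_simp)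
    have h4 := hS.smul_mem_of_zero_mem h0 h3 ⟨h.le, huv⟩
    convert h4 using 1
    rw [smul_add, smul_smul, smul_smul]
    congr 2 <;> field_simp

/-- A symmetric convex set containing `P`, `Q` and `Q - P` contains the affine-regular hexagon
with these vertices. -/
theorem Convex.hexagon_mem {E : Type*} [AddCommGroup E] [Module ℝ E] {S : Set E}
    (hS : Convex ℝ S) (hneg : ∀ p ∈ S, -p ∈ S) {P Q : E} (hP : P ∈ S) (hQ : Q ∈ S)
    (hR : Q - P ∈ S) {u v : ℝ} (hu : |u| ≤ 1) (hv : |v| ≤ 1) (huv : |u + v| ≤ 1) :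
    u • P + v • Q ∈ S := by
  have h0 : (0 : E) ∈ S := by
    have := hS hP (hneg P hP) (show (0 : ℝ) ≤ 1 / 2 by norm_num)
      (show (0 : ℝ) ≤ 1 / 2 by norm_num) (by norm_num)
    simpa using this
  have key : ∀ u v : ℝ, 0 ≤ u → |u| ≤ 1 → |v| ≤ 1 → |u + v| ≤ 1 → u • P + v • Q ∈ S := by
    intro u v hu0 hu hv huv
    rw [abs_le] at hu hv huv
    rcases le_total 0 v with hv0 | hv0
    · exact hS.add_smul_mem_of_add_le_one h0 hP hQ hu0 hv0 huv.2
    · rcases le_total 0 (u + v) with h | h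
      · have := hS.add_smul_mem_of_add_le_one h0 hP (hneg _ hR) h (neg_nonneg.2 hv0)
          (by linarith)
        convert this using 1
        module
      · have := hS.add_smul_mem_of_add_le_one h0 (hneg _ hR) (hneg _ hQ) hu0 (neg_nonneg.2 h)
          (by linarith)
        convert this using 1
        module
  rcases le_total 0 u with h | h
  · exact key u v h hu hv huv
  · have := hneg _ (key (-u) (-v) (by linarith) (by rwa [abs_neg]) (by rwa [abs_neg])
      (by rwa [← neg_add, abs_neg]))
    convert this using 1
    module

/-- If a convex set contains `P`, `Q` and a point strictly beyond the line `PQ`, then it reaches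
strictly beyond the midpoint of `P` and `Q`. -/
theorem Convex.exists_smul_midpoint_mem {E : Type*} [AddCommGroup E] [Module ℝ E] {S : Set E}
    (hS : Convex ℝ S) {P Q : E} (hP : P ∈ S) (hQ : Q ∈ S) {u v : ℝ}
    (h : u • P + v • Q ∈ S) (huv : 1 < u + v) :
    ∃ c : ℝ, 1 < c ∧ c • ((1 / 2 : ℝ) • (P + Q)) ∈ S := by
  have hd : 0 < 1 + |u - v| := by positivity
  -- Weight `g` goes to the far point; the rest is split between `P` and `Q` so that their total
  -- coefficients agree. This `g` is the largest that keeps both weights nonnegative.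
  obtain ⟨g, hg⟩ : ∃ g : ℝ, g = (1 + |u - v|)⁻¹ := ⟨_, rfl⟩
  have hg0 : 0 < g := by rw [hg]; positivity
  have hg1 : g + g * |u - v| = 1 := by rw [hg]; field_simp
  have h1 : g * (u - v) ≤ g * |u - v| := mul_le_mul_of_nonneg_left (le_abs_self _) hg0.le
  have h2 : -(g * |u - v|) ≤ g * (u - v) := by
    have := mul_le_mul_of_nonneg_left (neg_abs_le (u - v)) hg0.le
    linarith
  have key := hS.sum_mem (t := (Finset.univ : Finset (Fin 3)))
    (w := ![g, (1 - g - g * (u - v)) / 2, (1 - g + g * (u - v)) / 2])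
    (z := ![u • P + v • Q, P, Q]) ?_ ?_ ?_
  · refine ⟨1 + g * (u + v - 1), by nlinarith, ?_⟩
    convert key using 1
    simp only [Fin.sum_univ_three, Matrix.cons_val]
    module
  · intro i _
    fin_cases i <;> simp <;> linarith
  · simp [Fin.sum_univ_three]; ring
  · intro i _
    fin_cases i <;> simpa

/-! ### Bodies in reduced position -/

/-- A symmetric convex planar set in reduced position: its first minimum with respect to `ℤ²` is
`1`, attained at `(1, 0)`, and every lattice functional takes the value `t` on it. -/
structure IsReducedBody (t : ℝ) (S : Set (ℝ × ℝ)) : Prop where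
  convex : Convex ℝ S
  neg_mem : ∀ p ∈ S, -p ∈ S
  basis_mem : ((1 : ℝ), (0 : ℝ)) ∈ S
  lattice : ∀ m n : ℤ, (m ≠ 0 ∨ n ≠ 0) → ∀ c : ℝ, 1 < c → (c * m, c * n) ∉ S
  width : ∀ m n : ℤ, (m ≠ 0 ∨ n ≠ 0) → ∃ p ∈ S, m * p.1 + n * p.2 = t

namespace IsReducedBody

variable {t : ℝ} {S : Set (ℝ × ℝ)}

/-- Otherwise dividing by `u + v` puts a multiple of the lattice point with factor above 1 on the
segment between two points of the body. -/
theorem one_le_add (h : IsReducedBody t S) {x y x' y' u v : ℝ} (hP : (x, y) ∈ S)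
    (hQ : (x', y') ∈ S) (hu : 0 ≤ u) (hv : 0 ≤ v) (m n : ℤ) (hmn : m ≠ 0 ∨ n ≠ 0)
    (hm : u * x + v * x' = m) (hn : u * y + v * y' = n) : 1 ≤ u + v := by
  by_contra! hlt
  have hpos : 0 < u + v := by
    rcases (add_nonneg hu hv).eq_or_lt with h0 | h0
    · have h1 : u = 0 := by linarith
      have h2 : v = 0 := by linarith
      subst h1 h2
      simp only [zero_mul, add_zero] at hm hn
      have hm' : m = 0 := by exact_mod_cast hm.symm
      have hn' : n = 0 := by exact_mod_cast hn.symm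
      simp [hm', hn'] at hmn
    · exact h0
  refine h.lattice m n hmn (u + v)⁻¹ ((one_lt_inv₀ hpos).2 hlt) ?_
  have h3 := h.convex hP hQ (div_nonneg hu hpos.le) (div_nonneg hv hpos.le) (by field_simp)
  convert h3 using 1
  ext
  · simp only [← hm, Prod.smul_mk, Prod.mk_add_mk, smul_eq_mul]; field_simp
  · simp only [← hn, Prod.smul_mk, Prod.mk_add_mk, smul_eq_mul]; field_simp

theorem shear (h : IsReducedBody t S) (k : ℤ) :
    IsReducedBody t {p | (p.1 + k * p.2, p.2) ∈ S} where
  convex := by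
    intro p hp q hq u v hu hv huv
    have := h.convex hp hq hu hv huv
    simp only [Set.mem_ofPred_eq]
    convert this using 1
    ext <;> simp
    ring
  neg_mem := by
    intro p hp
    have := h.neg_mem _ hp
    simp only [Set.mem_ofPred_eq]
    convert this using 1
    ext <;> simp
    ring
  basis_mem := by simpa using h.basis_mem
  lattice := by
    intro m n hmn c hc hmem
    refine h.lattice (m + k * n) n (by grind) c hc ?_
    simp only [Set.mem_ofPred_eq] at hmem
    convert hmem using 2
    push_cast; ring
  width := by
    intro m n hmn
    obtain ⟨p, hp, hpt⟩ := h.width m (n - k * m) (by grind)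
    refine ⟨(p.1 - k * p.2, p.2), by simpa using hp, ?_⟩
    push_cast at hpt
    rw [← hpt]
    ring

/-- This symmetry preserves the functional `y` and exchanges `x` with `y - x`, so statements about
the line `x = t` transfer to `x - y = ±t`. -/
theorem reflect (h : IsReducedBody t S) : IsReducedBody t {p | (p.2 - p.1, p.2) ∈ S} where
  convex := by
    intro p hp q hq u v hu hv huv
    have := h.convex hp hq hu hv huv
    simp only [Set.mem_ofPred_eq]
    convert this using 1
    ext <;> simp
    ring
  neg_mem := by
    intro p hp
    have := h.neg_mem _ hp
    simp only [Set.mem_ofPred_eq]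
    convert this using 1
    ext <;> simp
    ring
  basis_mem := by simpa using h.neg_mem _ h.basis_mem
  lattice := by
    intro m n hmn c hc hmem
    refine h.lattice (n - m) n (by grind) c hc ?_
    simp only [Set.mem_ofPred_eq] at hmem
    convert hmem using 2
    push_cast; ring
  width := by
    intro m n hmn
    obtain ⟨p, hp, hpt⟩ := h.width (-m) (m + n) (by grind)
    refine ⟨(p.2 - p.1, p.2), by simpa using hp, ?_⟩
    push_cast at hpt
    simp only
    linarith

/-- The point of the body on the line `x = t` has ordinate strictly between `0` and `t`. -/
theorem ordinate_mem_Ioo (h : IsReducedBody t S) (ht : 4 / 3 ≤ t) {a b : ℝ}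
    (hP : (a, t) ∈ S) (ha : a ∈ Set.Ioo 0 t) (hQ : (t, b) ∈ S) : b ∈ Set.Ioo 0 t := by
  obtain ⟨ha0, hat⟩ := ha
  have hb1 : b < t := by
    by_contra! hb
    have hb0 : 0 < b := by linarith
    -- A point this steep has (1,1) in the cone over (1,0) and itself, with coefficient sum below 1.
    have := h.one_le_add h.basis_mem hQ (u := 1 - t / b) (v := 1 / b)
      (by rw [sub_nonneg, div_le_one hb0]; exact hb) (by positivity) 1 1 (by simp)
      (by field_simp; push_cast; ring) (by field_simp; push_cast; ring)
    have h2 : 1 - t / b + 1 / b = 1 - (t - 1) / b := by ring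
    have h3 : 0 < (t - 1) / b := div_pos (by linarith) hb0
    linarith
  have hb2 : -t < b := by
    by_contra! hb
    have hb0 : 0 < -b := by linarith
    have hb' : b ≠ 0 := by linarith
    have := h.one_le_add h.basis_mem hQ (u := 1 - t / (-b)) (v := 1 / (-b))
      (by rw [sub_nonneg, div_le_one hb0]; linarith) (by positivity) 1 (-1) (by simp)
      (by field_simp; push_cast; ring) (by field_simp; push_cast; ring)
    have h2 : 1 - t / (-b) + 1 / (-b) = 1 - (t - 1) / (-b) := by ring
    have h3 : 0 < (t - 1) / (-b) := div_pos (by linarith) hb0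
    linarith
  refine ⟨?_, hb1⟩
  by_contra! hb
  obtain ⟨β, rfl⟩ : ∃ β, b = -β := ⟨-b, by ring⟩
  have hβ : 0 ≤ β := by linarith
  have hD : 0 < t ^ 2 + a * β := by positivity
  -- For `b = -β ≤ 0`, (1,0) and (0,1) lie in the cones over `P,Q` and `P,-Q`. They yield `β(1-a) ≥
  -- 4/9` and `a(1-β) ≥ 4/9`, so `a` and `β` lie in (0,1); but the product of the left sides is at
  -- most 1/16.
  have h1 := h.one_le_add hP hQ (u := β / (t ^ 2 + a * β)) (v := t / (t ^ 2 + a * β))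
    (by positivity) (by positivity) 1 0 (by simp)
    (by field_simp; push_cast; ring) (by field_simp; push_cast; ring)
  have h2 := h.one_le_add hP (h.neg_mem _ hQ) (u := t / (t ^ 2 + a * β))
    (v := a / (t ^ 2 + a * β)) (by positivity) (by positivity) 0 1 (by simp)
    (by field_simp; push_cast; ring)
    (by field_simp; push_cast; ring)
  rw [← add_div, le_div_iff₀ hD] at h1 h2
  have h3 : 4 / 9 ≤ t * (t - 1) := by nlinarith
  have h4 : 4 / 9 ≤ β * (1 - a) := by linarith
  have h5 : 4 / 9 ≤ a * (1 - β) := by linarith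
  nlinarith [sq_nonneg (a + β - 1), sq_nonneg (a - β)]

end IsReducedBody

/-- AM-GM; the lower bounds `-s` exclude the case of two negative factors, whose product would be
below `s²`. -/
theorem add_ge_two_mul_of_sq_le_mul {s x y : ℝ} (hs : 0 < s) (hx : -s < x) (hy : -s < y)
    (hxy : s ^ 2 ≤ x * y) : 2 * s ≤ x + y := by
  have hx0 : 0 < x := by
    by_contra! hx0
    nlinarith
  have hy0 : 0 < y := by
    by_contra! hy0
    nlinarith
  nlinarith [sq_nonneg (x - y)]

namespace IsReducedBody

variable {t : ℝ} {S : Set (ℝ × ℝ)}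

/-- Adding the AM-GM bounds `m1`, `m2`, `m3` cancels `a, b, c` and leaves `9(t-1) ≤ 3`. At `t = 4/3`
all three are equalities, and `k1` becomes `(a - 2/3)² ≤ 0`. -/
theorem eq_of_four_thirds_le (h : IsReducedBody t S) (ht : 4 / 3 ≤ t) {a b c : ℝ}
    (ha : a ∈ Set.Ioo 0 t) (hb : b ∈ Set.Ioo 0 t) (hc : c ∈ Set.Ioo 0 t)
    (hP : (a, t) ∈ S) (hQ : (t, b) ∈ S) (hR : (c, c - t) ∈ S) :
    t = 4 / 3 ∧ a = 2 / 3 ∧ b = 2 / 3 ∧ c = 2 / 3 := by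
  obtain ⟨ha0, hat⟩ := ha
  obtain ⟨hb0, hbt⟩ := hb
  obtain ⟨hc0, hct⟩ := hc
  have hta : 0 < t - a := by linarith
  have htb : 0 < t - b := by linarith
  have htc : 0 < t - c := by linarith
  have hD1 : 0 < t ^ 2 - a * b := by nlinarith
  have hD2 : 0 < t * (t - c) + b * c := by positivity
  have hD3 : 0 < c * t + a * (t - c) := by positivity
  have h1 := h.one_le_add hP hQ (u := (t - b) / (t ^ 2 - a * b)) (v := (t - a) / (t ^ 2 - a * b))
    (by positivity) (by positivity) 1 1 (by simp)
    (by rw [div_mul_eq_mul_div, div_mul_eq_mul_div, ← add_div, div_eq_iff hD1.ne']; push_cast; ring)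
    (by rw [div_mul_eq_mul_div, div_mul_eq_mul_div, ← add_div, div_eq_iff hD1.ne']; push_cast; ring)
  have h2 := h.one_le_add hQ hR (u := (t - c) / (t * (t - c) + b * c))
    (v := b / (t * (t - c) + b * c)) (by positivity) (by positivity) 1 0 (by simp)
    (by field_simp; push_cast; ring) (by field_simp; push_cast; ring)
  have h3 := h.one_le_add hP (h.neg_mem _ hR) (u := c / (c * t + a * (t - c)))
    (v := a / (c * t + a * (t - c))) (by positivity) (by positivity) 0 1 (by simp)
    (by field_simp; push_cast; ring) (by field_simp; push_cast; ring)
  rw [← add_div, le_div_iff₀ hD1] at h1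
  rw [← add_div, le_div_iff₀ hD2] at h2
  rw [← add_div, le_div_iff₀ hD3] at h3
  have hs : 0 < t - 1 := by linarith
  have k1 : (t - 1) ^ 2 ≤ (1 - a) * (1 - b) := by linarith
  have k2 : (t - 1) ^ 2 ≤ (b - (t - 1)) * (1 - c) := by linarith
  have k3 : (t - 1) ^ 2 ≤ (c - (t - 1)) * (a - (t - 1)) := by linarith
  have m1 := add_ge_two_mul_of_sq_le_mul hs (by linarith) (by linarith) k1
  have m2 := add_ge_two_mul_of_sq_le_mul hs (by linarith) (by linarith) k2
  have m3 := add_ge_two_mul_of_sq_le_mul hs (by linarith) (by linarith) k3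
  have htt : t = 4 / 3 := by linarith
  subst htt
  have e1 : b = 4 / 3 - a := by linarith
  have e2 : c = 4 / 3 - a := by linarith
  subst e1 e2
  have ea : (a - 2 / 3) ^ 2 = 0 := le_antisymm (by linarith) (sq_nonneg _)
  have ea' := pow_eq_zero_iff two_ne_zero |>.1 ea
  refine ⟨rfl, ?_, ?_, ?_⟩ <;> linarith

/-- The edge midpoints are, up to sign, (1,1), (1,0) and (0,1). A point beyond an edge would put a
multiple of its midpoint with factor above 1 in the body. -/
theorem mem_iff_of_hexagon_subset (h : IsReducedBody t S) (hP : (2 / 3, 4 / 3) ∈ S)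
    (hQ : (4 / 3, 2 / 3) ∈ S) (hR : (2 / 3, -2 / 3) ∈ S) (p : ℝ × ℝ) :
    p ∈ S ↔ |p.1 + p.2| ≤ 2 ∧ |2 * p.1 - p.2| ≤ 2 ∧ |2 * p.2 - p.1| ≤ 2 := by
  have hQP : ((4 / 3, 2 / 3) : ℝ × ℝ) - (2 / 3, 4 / 3) = (2 / 3, -2 / 3) := by
    ext <;> norm_num
  have upper : ∀ p ∈ S, p.1 + p.2 ≤ 2 ∧ 2 * p.1 - p.2 ≤ 2 ∧ 2 * p.2 - p.1 ≤ 2 := by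
    intro p hp
    refine ⟨?_, ?_, ?_⟩ <;> by_contra! hlt
    · obtain ⟨c, hc, hm⟩ := h.convex.exists_smul_midpoint_mem hP hQ
        (u := (2 * p.2 - p.1) / 2) (v := (2 * p.1 - p.2) / 2)
        (by convert hp using 1; ext <;> simp <;> ring) (by linarith)
      refine h.lattice 1 1 (by simp) c hc ?_
      convert hm using 1
      ext <;> norm_num
    · obtain ⟨c, hc, hm⟩ := h.convex.exists_smul_midpoint_mem hQ hR
        (u := (p.1 + p.2) / 2) (v := (p.1 - 2 * p.2) / 2)
        (by convert hp using 1; ext <;> simp <;> ring) (by linarith)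
      refine h.lattice 1 0 (by simp) c hc ?_
      convert hm using 1
      ext <;> norm_num
    · obtain ⟨c, hc, hm⟩ := h.convex.exists_smul_midpoint_mem hP (h.neg_mem _ hR)
        (u := (p.1 + p.2) / 2) (v := (p.2 - 2 * p.1) / 2)
        (by convert hp using 1; ext <;> simp <;> ring) (by linarith)
      refine h.lattice 0 1 (by simp) c hc ?_
      convert hm using 1
      ext <;> norm_num
  constructor
  · intro hp
    have h1 := upper p hp
    have h2 := upper _ (h.neg_mem p hp)
    simp only [Prod.fst_neg, Prod.snd_neg] at h2
    refine ⟨abs_le.2 ⟨?_, ?_⟩, abs_le.2 ⟨?_, ?_⟩, abs_le.2 ⟨?_, ?_⟩⟩ <;> linarith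
  · rintro ⟨h1, h2, h3⟩
    have := h.convex.hexagon_mem h.neg_mem hP hQ (by rwa [hQP])
      (u := (2 * p.2 - p.1) / 2) (v := (2 * p.1 - p.2) / 2)
      (by rw [abs_le] at *; constructor <;> linarith)
      (by rw [abs_le] at *; constructor <;> linarith)
      (by rw [abs_le] at *; constructor <;> linarith)
    convert this using 1
    ext <;> simp <;> ring

theorem mem_iff_of_mem_line (h : IsReducedBody t S) (ht : 4 / 3 ≤ t) {a : ℝ}
    (ha : a ∈ Set.Ioo 0 t) (hP : (a, t) ∈ S) :
    t = 4 / 3 ∧ ∀ p : ℝ × ℝ,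
      p ∈ S ↔ |p.1 + p.2| ≤ 2 ∧ |2 * p.1 - p.2| ≤ 2 ∧ |2 * p.2 - p.1| ≤ 2 := by
  obtain ⟨⟨x, b⟩, hQ, hx⟩ := h.width 1 0 (by simp)
  obtain rfl : x = t := by simpa using hx
  obtain ⟨⟨c, d⟩, hR, hcd⟩ := h.width 1 (-1) (by simp)
  obtain rfl : d = c - x := by simp at hcd; linarith
  have hb := h.ordinate_mem_Ioo ht hP ha hQ
  -- Reflection sends `P` to `(t-a, t)` and `-R` to `(t, t-c)`.
  have hc := h.reflect.ordinate_mem_Ioo ht (a := x - a) (b := x - c) (by simpa using hP)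
    ⟨by linarith [ha.2], by linarith [ha.1]⟩
    (by
      have := h.neg_mem _ hR
      simp only [Set.mem_ofPred_eq]
      convert this using 1
      ext <;> simp)
  obtain ⟨ht', rfl, rfl, rfl⟩ := h.eq_of_four_thirds_le ht ha hb
    ⟨by linarith [hc.2], by linarith [hc.1]⟩ hP hQ hR
  subst ht'
  refine ⟨rfl, h.mem_iff_of_hexagon_subset hP hQ ?_⟩
  convert hR using 2
  norm_num

theorem eq_hexagon (h : IsReducedBody t S) (ht : 4 / 3 ≤ t) :
    t = 4 / 3 ∧ ∃ k : ℤ, ∀ p : ℝ × ℝ, (p.1 + k * p.2, p.2) ∈ S ↔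
      |p.1 + p.2| ≤ 2 ∧ |2 * p.1 - p.2| ≤ 2 ∧ |2 * p.2 - p.1| ≤ 2 := by
  obtain ⟨⟨a, y⟩, hP, hy⟩ := h.width 0 1 (by simp)
  obtain rfl : y = t := by simpa using hy
  have ht0 : 0 < y := by linarith
  -- If `a` were a multiple `k t`, the point would be `t (k,1)` with `t > 1`.
  have hne : a - ⌊a / y⌋ * y ≠ 0 := by
    intro h0
    refine h.lattice ⌊a / y⌋ 1 (by simp) y (by linarith) ?_
    convert hP using 2
    · linarith
    · simp
  have h1 := Int.floor_le (a / y)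
  have h2 := Int.lt_floor_add_one (a / y)
  rw [le_div_iff₀ ht0] at h1
  rw [div_lt_iff₀ ht0] at h2
  obtain ⟨e, hS⟩ := (h.shear ⌊a / y⌋).mem_iff_of_mem_line ht (a := a - ⌊a / y⌋ * y)
    ⟨lt_of_le_of_ne (by linarith) hne.symm, by linarith⟩ (by simpa using hP)
  exact ⟨e, _, hS⟩

end IsReducedBody

/-! ### The extremal hexagon by its edge inequalities -/

theorem mem_extremalHexagon {x : EuclideanSpace ℝ (Fin 2)} : x ∈ extremalHexagon ↔
    |x 0 + x 1| ≤ 3 ∧ |2 * x 0 - x 1| ≤ 3 ∧ |2 * x 1 - x 0| ≤ 3 := by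
  constructor
  · intro hx
    refine convexHull_min (t := {x : EuclideanSpace ℝ (Fin 2) |
      |x 0 + x 1| ≤ 3 ∧ |2 * x 0 - x 1| ≤ 3 ∧ |2 * x 1 - x 0| ≤ 3}) ?_ ?_ hx
    · intro y hy
      simp only [Set.mem_insert_iff, Set.mem_singleton_iff] at hy
      rcases hy with rfl | rfl | rfl | rfl | rfl | rfl <;> simp [abs_le] <;> norm_num
    · intro y hy z hz u v hu hv huv
      simp only [Set.mem_ofPred_eq, abs_le, PiLp.add_apply, PiLp.smul_apply, smul_eq_mul] at *
      obtain rfl : v = 1 - u := by linarith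
      refine ⟨⟨?_, ?_⟩, ⟨?_, ?_⟩, ⟨?_, ?_⟩⟩ <;> nlinarith
  · rintro ⟨h1, h2, h3⟩
    have hneg : ∀ p ∈ extremalHexagon, -p ∈ extremalHexagon := by
      intro p hp
      have h := Set.neg_mem_neg.2 hp
      rw [extremalHexagon, ← convexHull_neg] at h
      refine convexHull_mono ?_ h
      intro y hy
      simp only [Set.mem_neg, Set.mem_insert_iff, Set.mem_singleton_iff, neg_inj] at hy ⊢
      simp only [neg_eq_iff_eq_neg] at hy
      tauto
    have := (convex_convexHull ℝ _).hexagon_mem hneg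
      (P := (!₂[1, 2] : EuclideanSpace ℝ (Fin 2))) (Q := !₂[2, 1])
      (subset_convexHull ℝ _ (by simp)) (subset_convexHull ℝ _ (by simp))
      (subset_convexHull ℝ _ (by
        have : (!₂[2, 1] - !₂[1, 2] : EuclideanSpace ℝ (Fin 2)) = -!₂[-1, 1] := by
          ext i; fin_cases i <;> simp <;> norm_num
        simp [this]))
      (u := (2 * x 1 - x 0) / 3) (v := (2 * x 0 - x 1) / 3)
      (by rw [abs_le] at *; constructor <;> linarith)
      (by rw [abs_le] at *; constructor <;> linarith)
      (by rw [abs_le] at *; constructor <;> linarith)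
    change _ ∈ extremalHexagon at this
    convert this using 1
    ext i
    fin_cases i <;> simp <;> ring

/-! ### First minima, gauges and lattice points -/

theorem inter_integerLattice_ne_iff {X : Set (EuclideanSpace ℝ (Fin 2))} (h0 : 0 ∈ X) :
    X ∩ integerLattice 2 ≠ {0} ↔
      ∃ m n : ℤ, (m ≠ 0 ∨ n ≠ 0) ∧ !₂[(m : ℝ), (n : ℝ)] ∈ X := by
  constructor
  · intro h
    by_contra! hh
    refine h (Set.eq_singleton_iff_unique_mem.2 ⟨⟨h0, fun i => ⟨0, by simp⟩⟩, ?_⟩)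
    rintro x ⟨hx, hl⟩
    obtain ⟨m, hm⟩ := hl 0
    obtain ⟨n, hn⟩ := hl 1
    have hxe : x = !₂[(m : ℝ), (n : ℝ)] := by ext i; fin_cases i <;> simp [hm, hn]
    by_contra hx0
    refine hh m n ?_ (hxe ▸ hx)
    by_contra! hmn
    exact hx0 (by rw [hxe, hmn.1, hmn.2]; ext i; fin_cases i <;> simp)
  · rintro ⟨m, n, hmn, hX⟩ h
    have : !₂[(m : ℝ), (n : ℝ)] ∈ X ∩ integerLattice 2 :=
      ⟨hX, fun i => by fin_cases i; exacts [⟨m, by simp⟩, ⟨n, by simp⟩]⟩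
    rw [h, Set.mem_singleton_iff] at this
    have h1 := congrArg (fun x : EuclideanSpace ℝ (Fin 2) => x 0) this
    have h2 := congrArg (fun x : EuclideanSpace ℝ (Fin 2) => x 1) this
    simp at h1 h2
    simp [h1, h2] at hmn

theorem firstMinimum_le {X : Set (EuclideanSpace ℝ (Fin 2))} (h0 : 0 ∈ X) {t : ℝ} (ht : 0 ≤ t)
    {m n : ℤ} (hmn : m ≠ 0 ∨ n ≠ 0) (h : !₂[(m : ℝ), (n : ℝ)] ∈ t • X) :
    firstMinimum X ≤ t :=
  csInf_le ⟨0, fun _ hs => hs.1⟩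
    ⟨ht, (inter_integerLattice_ne_iff (X := t • X) ⟨0, h0, by simp⟩).2 ⟨m, n, hmn, h⟩⟩

theorem le_firstMinimum {X : Set (EuclideanSpace ℝ (Fin 2))} (h0 : 0 ∈ X) {s : ℝ}
    (hne : ∃ t : ℝ, 0 ≤ t ∧ ∃ m n : ℤ, (m ≠ 0 ∨ n ≠ 0) ∧ !₂[(m : ℝ), (n : ℝ)] ∈ t • X)
    (h : ∀ t : ℝ, 0 ≤ t → ∀ m n : ℤ, (m ≠ 0 ∨ n ≠ 0) → !₂[(m : ℝ), (n : ℝ)] ∈ t • X → s ≤ t) :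
    s ≤ firstMinimum X := by
  have hiff (t : ℝ) := inter_integerLattice_ne_iff (X := t • X) ⟨0, h0, by simp⟩
  refine le_csInf ?_ ?_
  · obtain ⟨t, ht, hh⟩ := hne
    exact ⟨t, ht, (hiff t).2 hh⟩
  · rintro t ⟨ht, hh⟩
    obtain ⟨m, n, hmn, hX⟩ := (hiff t).1 hh
    exact h t ht m n hmn hX

theorem latticePoint_ne_zero {m n : ℤ} (hmn : m ≠ 0 ∨ n ≠ 0) :
    !₂[(m : ℝ), (n : ℝ)] ≠ (0 : EuclideanSpace ℝ (Fin 2)) := by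
  intro this
  have h1 := congrArg (fun x : EuclideanSpace ℝ (Fin 2) => x 0) this
  have h2 := congrArg (fun x : EuclideanSpace ℝ (Fin 2) => x 1) this
  simp at h1 h2
  simp [h1, h2] at hmn

namespace ConvexBody

variable (K : ConvexBody (EuclideanSpace ℝ (Fin 2)))

theorem mem_iff_gauge_le_one (hint : 0 ∈ interior (K : Set (EuclideanSpace ℝ (Fin 2))))
    (x : EuclideanSpace ℝ (Fin 2)) :
    x ∈ (K : Set (EuclideanSpace ℝ (Fin 2))) ↔ gauge (K : Set _) x ≤ 1 := by
  rw [gauge_le_one_iff_mem_closure K.convex (mem_interior_iff_mem_nhds.1 hint),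
    K.isClosed.closure_eq]

theorem mem_smul_iff_gauge_le (hint : 0 ∈ interior (K : Set (EuclideanSpace ℝ (Fin 2))))
    {t : ℝ} (ht : 0 < t) (x : EuclideanSpace ℝ (Fin 2)) :
    x ∈ t • (K : Set (EuclideanSpace ℝ (Fin 2))) ↔ gauge (K : Set _) x ≤ t := by
  rw [Set.mem_smul_set_iff_inv_smul_mem₀ ht.ne', K.mem_iff_gauge_le_one hint,
    gauge_smul_of_nonneg (inv_nonneg.2 ht.le), smul_eq_mul, inv_mul_le_iff₀ ht, mul_one]

theorem gauge_pos' (hint : 0 ∈ interior (K : Set (EuclideanSpace ℝ (Fin 2))))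
    {x : EuclideanSpace ℝ (Fin 2)} (hx : x ≠ 0) : 0 < gauge (K : Set _) x :=
  (gauge_pos (absorbent_nhds_zero (mem_interior_iff_mem_nhds.1 hint))
    (NormedSpace.isVonNBounded_of_isBounded ℝ K.isBounded)).2 hx

/-- Boundedness of the body leaves only finitely many lattice points with gauge at most that of
(1,0). -/
theorem exists_isMin_gauge_latticePoint
    (hint : 0 ∈ interior (K : Set (EuclideanSpace ℝ (Fin 2)))) :
    ∃ m n : ℤ, (m ≠ 0 ∨ n ≠ 0) ∧ ∀ m' n' : ℤ, (m' ≠ 0 ∨ n' ≠ 0) →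
      gauge (K : Set _) !₂[(m : ℝ), (n : ℝ)] ≤ gauge (K : Set _) !₂[(m' : ℝ), (n' : ℝ)] := by
  obtain ⟨R, hR, hKR⟩ := K.isBounded.subset_closedBall_lt 0 0
  obtain ⟨M, hM⟩ := exists_nat_ge (R * gauge (K : Set _) !₂[((1 : ℤ) : ℝ), ((0 : ℤ) : ℝ)])
  obtain ⟨F, hF⟩ : ∃ F : Set (ℤ × ℤ), F = {z | (z.1 ≠ 0 ∨ z.2 ≠ 0) ∧
    gauge (K : Set _) !₂[(z.1 : ℝ), (z.2 : ℝ)] ≤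
      gauge (K : Set _) !₂[((1 : ℤ) : ℝ), ((0 : ℤ) : ℝ)]} := ⟨_, rfl⟩
  have hfin : F.Finite := by
    refine (Set.finite_Icc ((-M, -M) : ℤ × ℤ) (M, M)).subset ?_
    intro z hz
    rw [hF] at hz
    have h1 := le_gauge_of_subset_closedBall (x := !₂[(z.1 : ℝ), (z.2 : ℝ)])
      (absorbent_nhds_zero (mem_interior_iff_mem_nhds.1 hint)) hR.le hKR
    have h2 := h1.trans hz.2
    rw [div_le_iff₀ hR] at h2
    have h3 : ‖!₂[(z.1 : ℝ), (z.2 : ℝ)]‖ ≤ M := by linarith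
    have h4 := (PiLp.norm_apply_le (!₂[(z.1 : ℝ), (z.2 : ℝ)] : EuclideanSpace ℝ (Fin 2)) 0).trans h3
    have h5 := (PiLp.norm_apply_le (!₂[(z.1 : ℝ), (z.2 : ℝ)] : EuclideanSpace ℝ (Fin 2)) 1).trans h3
    simp only [Matrix.cons_val, Real.norm_eq_abs, abs_le] at h4 h5
    exact ⟨⟨by exact_mod_cast h4.1, by exact_mod_cast h5.1⟩,
      ⟨by exact_mod_cast h4.2, by exact_mod_cast h5.2⟩⟩
  have h10 : ((1, 0) : ℤ × ℤ) ∈ F := by rw [hF]; simp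
  obtain ⟨z, hz, hmin⟩ := Set.exists_min_image F
    (fun z => gauge (K : Set _) !₂[(z.1 : ℝ), (z.2 : ℝ)]) hfin ⟨_, h10⟩
  refine ⟨z.1, z.2, by rw [hF] at hz; exact hz.1, fun m' n' hmn => ?_⟩
  rcases le_or_gt (gauge (K : Set _) !₂[(m' : ℝ), (n' : ℝ)])
    (gauge (K : Set _) !₂[((1 : ℤ) : ℝ), ((0 : ℤ) : ℝ)]) with h | h
  · exact hmin (m', n') (by rw [hF]; exact ⟨hmn, h⟩)
  · exact (hmin _ h10).trans h.le

theorem firstMinimum_eq_gauge (hint : 0 ∈ interior (K : Set (EuclideanSpace ℝ (Fin 2))))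
    {m n : ℤ} (hmn : m ≠ 0 ∨ n ≠ 0) (hmin : ∀ m' n' : ℤ, (m' ≠ 0 ∨ n' ≠ 0) →
      gauge (K : Set _) !₂[(m : ℝ), (n : ℝ)] ≤ gauge (K : Set _) !₂[(m' : ℝ), (n' : ℝ)]) :
    firstMinimum (K : Set (EuclideanSpace ℝ (Fin 2))) =
      gauge (K : Set _) !₂[(m : ℝ), (n : ℝ)] := by
  have hpos := K.gauge_pos' hint (latticePoint_ne_zero hmn)
  have hmem := (K.mem_smul_iff_gauge_le hint hpos _).2 le_rfl
  refine le_antisymm (firstMinimum_le (interior_subset hint) hpos.le hmn hmem)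
    (le_firstMinimum (interior_subset hint) ⟨_, hpos.le, m, n, hmn, hmem⟩ ?_)
  intro t ht m' n' hmn' h
  rcases ht.eq_or_lt with rfl | ht
  · obtain ⟨y, -, hy⟩ := h
    exact absurd (by simpa using hy.symm) (latticePoint_ne_zero hmn')
  · exact (hmin m' n' hmn').trans ((K.mem_smul_iff_gauge_le hint ht _).1 h)

/-- The support function of `K` at a nonzero lattice point is attained, and the lattice point lies
in the corresponding multiple of the polar set. -/
theorem exists_mem_smul_polarSet (hint : 0 ∈ interior (K : Set (EuclideanSpace ℝ (Fin 2))))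
    {m n : ℤ} (hmn : m ≠ 0 ∨ n ≠ 0) : ∃ x ∈ (K : Set (EuclideanSpace ℝ (Fin 2))),
      0 < m * x 0 + n * x 1 ∧
      !₂[(m : ℝ), (n : ℝ)] ∈
        (m * x 0 + n * x 1) • polarSet (K : Set (EuclideanSpace ℝ (Fin 2))) := by
  have hinner (x : EuclideanSpace ℝ (Fin 2)) :
      inner ℝ x !₂[(m : ℝ), (n : ℝ)] = m * x 0 + n * x 1 := by
    simp [PiLp.inner_apply, Fin.sum_univ_two]
  obtain ⟨x, hx, hmax⟩ := K.isCompact.exists_isMaxOn ⟨0, interior_subset hint⟩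
    (f := fun x => inner ℝ x !₂[(m : ℝ), (n : ℝ)]) (by fun_prop)
  have hz := latticePoint_ne_zero hmn
  have hpos := K.gauge_pos' hint hz
  have hmem := (K.mem_smul_iff_gauge_le hint hpos _).2 le_rfl
  rw [Set.mem_smul_set_iff_inv_smul_mem₀ hpos.ne'] at hmem
  have h1 := hmax hmem
  simp only [Set.mem_ofPred_eq, inner_smul_left, RCLike.conj_to_real] at h1
  have h2 : 0 < inner ℝ x !₂[(m : ℝ), (n : ℝ)] :=
    lt_of_lt_of_le (mul_pos (inv_pos.2 hpos) (real_inner_self_pos.2 hz)) h1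
  refine ⟨x, hx, ?_⟩
  rw [← hinner]
  refine ⟨h2, (Set.mem_smul_set_iff_inv_smul_mem₀ h2.ne' _ _).2 fun y hy => ?_⟩
  rw [inner_smul_right, inv_mul_le_iff₀ h2, mul_one]
  exact hmax hy

end ConvexBody

/-! ### Unimodular images -/

theorem mem_unimodularImage {U : GL (Fin 2) ℤ} {X : Set (EuclideanSpace ℝ (Fin 2))}
    {x : EuclideanSpace ℝ (Fin 2)} : x ∈ unimodularImage U X ↔
      ∃ h ∈ X, x 0 = U 0 0 * h 0 + U 0 1 * h 1 ∧ x 1 = U 1 0 * h 0 + U 1 1 * h 1 := by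
  refine exists_congr fun h => and_congr_right fun _ => ?_
  constructor
  · rintro rfl
    simp [Matrix.toLpLin_apply]
  · rintro ⟨h0, h1⟩
    ext i
    fin_cases i
    · simp [Matrix.toLpLin_apply, h0]
    · simp [Matrix.toLpLin_apply, h1]

theorem mem_smul_unimodularImage {U : GL (Fin 2) ℤ} {X : Set (EuclideanSpace ℝ (Fin 2))} {l : ℝ}
    {x : EuclideanSpace ℝ (Fin 2)} : x ∈ l • unimodularImage U X ↔
      ∃ h ∈ X, x 0 = l * (U 0 0 * h 0 + U 0 1 * h 1) ∧
        x 1 = l * (U 1 0 * h 0 + U 1 1 * h 1) := by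
  constructor
  · rintro ⟨y, hy, rfl⟩
    obtain ⟨h, hX, h0, h1⟩ := mem_unimodularImage.1 hy
    exact ⟨h, hX, by simp [h0], by simp [h1]⟩
  · rintro ⟨h, hX, h0, h1⟩
    refine ⟨!₂[U 0 0 * h 0 + U 0 1 * h 1, U 1 0 * h 0 + U 1 1 * h 1],
      mem_unimodularImage.2 ⟨h, hX, by simp, by simp⟩, ?_⟩
    ext i
    fin_cases i
    · simp [h0]
    · simp [h1]

theorem exists_eq_smul_unimodularImage {X Y : Set (EuclideanSpace ℝ (Fin 2))} {l : ℝ}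
    (hl : 0 < l) {α β γ δ : ℤ} (hdet : α * δ - β * γ = 1)
    (h : ∀ x y : ℝ, !₂[l * (α * x + β * y), l * (γ * x + δ * y)] ∈ X ↔ !₂[x, y] ∈ Y) :
    ∃ U : GL (Fin 2) ℤ, X = l • unimodularImage U Y := by
  have hdet' : (α * δ - β * γ : ℝ) = 1 := by exact_mod_cast hdet
  let V : SL(2, ℤ) := ⟨!![α, β; γ, δ], by simp [Matrix.det_fin_two, hdet]⟩
  have e00 : (V : GL (Fin 2) ℤ) 0 0 = α := rfl
  have e01 : (V : GL (Fin 2) ℤ) 0 1 = β := rfl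
  have e10 : (V : GL (Fin 2) ℤ) 1 0 = γ := rfl
  have e11 : (V : GL (Fin 2) ℤ) 1 1 = δ := rfl
  refine ⟨V, ?_⟩
  ext x
  rw [mem_smul_unimodularImage, e00, e01, e10, e11]
  constructor
  · intro hx
    have h0 : x 0 = l * (α * (l⁻¹ * (δ * x 0 - β * x 1)) + β * (l⁻¹ * (α * x 1 - γ * x 0))) := by
      field_simp
      linear_combination (-x 0) * hdet'
    have h1 : x 1 = l * (γ * (l⁻¹ * (δ * x 0 - β * x 1)) + δ * (l⁻¹ * (α * x 1 - γ * x 0))) := by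
      field_simp
      linear_combination (-x 1) * hdet'
    refine ⟨_, (h (l⁻¹ * (δ * x 0 - β * x 1)) (l⁻¹ * (α * x 1 - γ * x 0))).1 ?_, h0, h1⟩
    rw [← h0, ← h1]
    convert hx using 1
    ext i
    fin_cases i <;> simp
  · rintro ⟨y, hy, h0, h1⟩
    have : !₂[y 0, y 1] = y := by ext i; fin_cases i <;> simp
    rw [← this, ← h] at hy
    convert hy using 1
    ext i
    fin_cases i
    · simp [h0]
    · simp [h1]

/-! ### Reduction of a body and the equality case -/

namespace ConvexBody

variable (K : ConvexBody (EuclideanSpace ℝ (Fin 2)))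

/-- A minimiser is primitive: dividing by a gcd above 1 would lower its gauge. -/
theorem exists_isCoprime_gauge_eq_firstMinimum
    (hint : 0 ∈ interior (K : Set (EuclideanSpace ℝ (Fin 2)))) :
    ∃ m n : ℤ, IsCoprime m n ∧
      firstMinimum (K : Set (EuclideanSpace ℝ (Fin 2))) =
        gauge (K : Set _) !₂[(m : ℝ), (n : ℝ)] ∧
      ∀ m' n' : ℤ, (m' ≠ 0 ∨ n' ≠ 0) →
        firstMinimum (K : Set (EuclideanSpace ℝ (Fin 2))) ≤
          gauge (K : Set _) !₂[(m' : ℝ), (n' : ℝ)] := by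
  obtain ⟨m, n, hmn, hmin⟩ := K.exists_isMin_gauge_latticePoint hint
  have heq := K.firstMinimum_eq_gauge hint hmn hmin
  refine ⟨m, n, ?_, heq, heq ▸ hmin⟩
  have hpos := K.gauge_pos' hint (latticePoint_ne_zero hmn)
  obtain ⟨a, ha⟩ := Int.gcd_dvd_left m n
  obtain ⟨b, hb⟩ := Int.gcd_dvd_right m n
  rw [Int.isCoprime_iff_gcd_eq_one]
  have hg : 0 < Int.gcd m n := Int.gcd_pos_iff.2 hmn
  generalize Int.gcd m n = g at *
  have hab : a ≠ 0 ∨ b ≠ 0 := by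
    by_contra! h
    simp [ha, hb, h.1, h.2] at hmn
  have h1 := hmin a b hab
  have h2 : !₂[(m : ℝ), (n : ℝ)] = (g : ℝ) • !₂[(a : ℝ), (b : ℝ)] := by
    rw [ha, hb]
    ext i
    fin_cases i <;> simp
  rw [h2, gauge_smul_of_nonneg (by positivity), smul_eq_mul] at h1 hpos
  have h3 : 0 < gauge (K : Set _) !₂[(a : ℝ), (b : ℝ)] :=
    K.gauge_pos' hint (latticePoint_ne_zero hab)
  have h4 : (g : ℝ) ≤ 1 := by
    by_contra! h
    nlinarith
  have h5 : g ≤ 1 := by exact_mod_cast h4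
  omega

theorem eq_smul_unimodularImage_of_four_thirds_le
    (hsymm : -(K : Set (EuclideanSpace ℝ (Fin 2))) = K)
    (hint : 0 ∈ interior (K : Set (EuclideanSpace ℝ (Fin 2))))
    (h43 : 4 / 3 ≤ firstMinimum (K : Set (EuclideanSpace ℝ (Fin 2))) *
      firstMinimum (polarSet (K : Set (EuclideanSpace ℝ (Fin 2))))) :
    firstMinimum (K : Set (EuclideanSpace ℝ (Fin 2))) *
        firstMinimum (polarSet (K : Set (EuclideanSpace ℝ (Fin 2)))) = 4 / 3 ∧
      ∃ (l : ℝ) (U : GL (Fin 2) ℤ), 0 < l ∧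
        (K : Set (EuclideanSpace ℝ (Fin 2))) = l • unimodularImage U extremalHexagon := by
  obtain ⟨m, n, ⟨u, v, huv⟩, hr, hmin⟩ := K.exists_isCoprime_gauge_eq_firstMinimum hint
  have hmn : m ≠ 0 ∨ n ≠ 0 := by
    by_contra! h
    simp [h.1, h.2] at huv
  have huv' : (u * m + v * n : ℝ) = 1 := by exact_mod_cast huv
  have hpos := K.gauge_pos' hint (latticePoint_ne_zero hmn)
  rw [← hr] at hpos
  generalize firstMinimum (K : Set (EuclideanSpace ℝ (Fin 2))) = r at *
  have hwidth : ∀ m' n' : ℤ, (m' ≠ 0 ∨ n' ≠ 0) → ∃ x ∈ (K : Set (EuclideanSpace ℝ (Fin 2))),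
      firstMinimum (polarSet (K : Set (EuclideanSpace ℝ (Fin 2)))) ≤ m' * x 0 + n' * x 1 := by
    intro m' n' h
    obtain ⟨x, hx, hx0, hx1⟩ := K.exists_mem_smul_polarSet hint h
    exact ⟨x, hx, firstMinimum_le (fun y _ => by simp) hx0.le h hx1⟩
  generalize firstMinimum (polarSet (K : Set (EuclideanSpace ℝ (Fin 2)))) = w at *
  -- `S = M⁻¹(rK)`, where `M` has columns `(m,n)` and `(-v,u)` and determinant 1.
  obtain ⟨S, hS⟩ : ∃ S : Set (ℝ × ℝ), S = {p | !₂[r⁻¹ * (m * p.1 - v * p.2),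
    r⁻¹ * (n * p.1 + u * p.2)] ∈ (K : Set (EuclideanSpace ℝ (Fin 2)))} := ⟨_, rfl⟩
  have hmemS (x y : ℝ) : (x, y) ∈ S ↔ !₂[r⁻¹ * (m * x - v * y),
      r⁻¹ * (n * x + u * y)] ∈ (K : Set (EuclideanSpace ℝ (Fin 2))) := by rw [hS]; rfl
  have hred : IsReducedBody (r * w) S := by
    refine ⟨?_, ?_, ?_, ?_, ?_⟩
    · rintro ⟨x, y⟩ hp ⟨x', y'⟩ hq a b ha hb hab
      rw [hmemS] at hp hq
      have := K.convex hp hq ha hb hab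
      simp only [Prod.smul_mk, Prod.mk_add_mk, smul_eq_mul]
      rw [hmemS]
      convert this using 1
      ext i
      fin_cases i <;> simp <;> ring
    · rintro ⟨x, y⟩ hp
      rw [hmemS] at hp
      simp only [Prod.neg_mk]
      rw [hmemS, ← hsymm, Set.mem_neg]
      convert hp using 1
      ext i
      fin_cases i <;> simp <;> ring
    · rw [hmemS, K.mem_iff_gauge_le_one hint]
      have : !₂[r⁻¹ * (m * 1 - v * 0), r⁻¹ * (n * 1 + u * 0)] =
          r⁻¹ • (!₂[(m : ℝ), (n : ℝ)] : EuclideanSpace ℝ (Fin 2)) := by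
        ext i
        fin_cases i <;> simp
      rw [this, gauge_smul_of_nonneg (inv_nonneg.2 hpos.le), ← hr, smul_eq_mul,
        inv_mul_cancel₀ hpos.ne']
    · intro a b hab c hc hmem
      rw [hmemS, K.mem_iff_gauge_le_one hint] at hmem
      have : !₂[r⁻¹ * (m * (c * a) - v * (c * b)), r⁻¹ * (n * (c * a) + u * (c * b))] =
          (r⁻¹ * c) • (!₂[((m * a - v * b : ℤ) : ℝ), ((n * a + u * b : ℤ) : ℝ)] :
            EuclideanSpace ℝ (Fin 2)) := by
        ext i
        fin_cases i <;> simp <;> ring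
      have hc0 : 0 < c := by linarith
      rw [this, gauge_smul_of_nonneg (by positivity), smul_eq_mul] at hmem
      have hle := hmin (m * a - v * b) (n * a + u * b) (by
        by_contra! h
        have h1 : a = 0 := by linear_combination u * h.1 + v * h.2 - a * huv
        have h2 : b = 0 := by linear_combination m * h.2 - n * h.1 - b * huv
        simp [h1, h2] at hab)
      have h1 : r⁻¹ * c * r ≤ 1 := (mul_le_mul_of_nonneg_left hle (by positivity)).trans hmem
      have h2 : r⁻¹ * c * r = c := by field_simp
      linarith
    · intro a b hab
      -- The covector is `(a,b) M⁻¹`.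
      obtain ⟨x, hx, hxw⟩ := hwidth (a * u - b * n) (a * v + b * m) (by
        by_contra! h
        have h1 : a = 0 := by linear_combination m * h.1 + n * h.2 - a * huv
        have h2 : b = 0 := by linear_combination u * h.2 - v * h.1 - b * huv
        simp [h1, h2] at hab)
      push_cast at hxw
      have hw : 0 < w := by
        by_contra! h
        nlinarith
      obtain ⟨s, hs⟩ : ∃ s : ℝ, s = (a * u - b * n) * x 0 + (a * v + b * m) * x 1 := ⟨_, rfl⟩
      rw [← hs] at hxw
      have hs0 : 0 < s := by linarith
      -- Shrinking `x` towards 0 by `w / s ≤ 1` makes the functional take exactly the value `w`.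
      have hxs := K.convex.smul_mem_of_zero_mem (interior_subset hint) hx
        (t := w / s) ⟨by positivity, (div_le_one hs0).2 hxw⟩
      refine ⟨(r * (w / s) * (u * x 0 + v * x 1), r * (w / s) * (m * x 1 - n * x 0)), ?_, ?_⟩
      · rw [hmemS]
        convert hxs using 1
        ext i
        fin_cases i
        · simp
          field_simp
          linear_combination x 0 * huv'
        · simp
          field_simp
          linear_combination x 1 * huv'
      · field_simp
        rw [hs]
        ring
  obtain ⟨h1, k, hk⟩ := hred.eq_hexagon h43
  -- The reduced hexagon is 2/3 of the extremal one, and `1 / r` undoes the scaling in `S`.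
  refine ⟨h1, 2 / (3 * r), ?_⟩
  have hl : 0 < 2 / (3 * r) := by positivity
  obtain ⟨U, hU⟩ := exists_eq_smul_unimodularImage (X := K) (Y := extremalHexagon) hl
    (α := m) (β := m * k - v) (γ := n) (δ := n * k + u) (by linear_combination huv) (by
      intro x y
      have hxy := hk (2 / 3 * x, 2 / 3 * y)
      rw [hmemS] at hxy
      have hpt : !₂[2 / (3 * r) * (m * x + ((m * k - v : ℤ) : ℝ) * y),
          2 / (3 * r) * (n * x + ((n * k + u : ℤ) : ℝ) * y)] =
          (!₂[r⁻¹ * (m * (2 / 3 * x + k * (2 / 3 * y)) - v * (2 / 3 * y)),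
            r⁻¹ * (n * (2 / 3 * x + k * (2 / 3 * y)) + u * (2 / 3 * y))] :
            EuclideanSpace ℝ (Fin 2)) := by
        congr 2
        · push_cast; field_simp; ring
        · congr 1; push_cast; field_simp; ring
      rw [mem_extremalHexagon, hpt, hxy]
      simp only [abs_le, Matrix.cons_val]
      constructor <;> rintro ⟨⟨_, _⟩, ⟨_, _⟩, ⟨_, _⟩⟩ <;>
        refine ⟨⟨?_, ?_⟩, ⟨?_, ?_⟩, ⟨?_, ?_⟩⟩ <;> linarith)
  exact ⟨U, hl, hU⟩

/-- The two minima are at least `2 / (3l)` and `2l`. Below either value, pulling back by `U` or its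
transpose gives integers `p, q` for which certain integer forms have absolute value below 2, hence
at most 1; this forces `p = q = 0`. -/
theorem four_thirds_le_of_eq_smul_unimodularImage
    (hint : 0 ∈ interior (K : Set (EuclideanSpace ℝ (Fin 2)))) {l : ℝ} (hl : 0 < l)
    {U : GL (Fin 2) ℤ}
    (hK : (K : Set (EuclideanSpace ℝ (Fin 2))) = l • unimodularImage U extremalHexagon) :
    4 / 3 ≤ firstMinimum (K : Set (EuclideanSpace ℝ (Fin 2))) *
      firstMinimum (polarSet (K : Set (EuclideanSpace ℝ (Fin 2)))) := by
  have hdet : U 0 0 * U 1 1 - U 0 1 * U 1 0 = 1 ∨ U 0 0 * U 1 1 - U 0 1 * U 1 0 = -1 := by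
    have := (Matrix.isUnit_iff_isUnit_det _).1 U.isUnit
    rwa [Matrix.det_fin_two, Int.isUnit_iff] at this
  have hdet0 : U 0 0 * U 1 1 - U 0 1 * U 1 0 ≠ 0 := by omega
  have h1 : 2 / (3 * l) ≤ firstMinimum (K : Set (EuclideanSpace ℝ (Fin 2))) := by
    refine le_firstMinimum (interior_subset hint) ?_ ?_
    · have hpos := K.gauge_pos' hint (latticePoint_ne_zero (m := 1) (n := 0) (by simp))
      exact ⟨_, hpos.le, 1, 0, by simp, (K.mem_smul_iff_gauge_le hint hpos _).2 le_rfl⟩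
    · rintro t ht a b hab ⟨x, hx, hxab⟩
      rw [hK, mem_smul_unimodularImage] at hx
      obtain ⟨y, hy, hy0, hy1⟩ := hx
      rw [mem_extremalHexagon] at hy
      have ha := congrArg (fun x : EuclideanSpace ℝ (Fin 2) => x 0) hxab
      have hb := congrArg (fun x : EuclideanSpace ℝ (Fin 2) => x 1) hxab
      simp [hy0, hy1] at ha hb
      generalize U 0 0 = α at *
      generalize U 0 1 = β at *
      generalize U 1 0 = γ at *
      generalize U 1 1 = δ at *
      -- `(p,q) = U⁻¹(a,b)`; the determinant, being ±1, serves as its own inverse.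
      obtain ⟨p, hp⟩ : ∃ p : ℤ, p = (α * δ - β * γ) * (δ * a - β * b) := ⟨_, rfl⟩
      obtain ⟨q, hq⟩ : ∃ q : ℤ, q = (α * δ - β * γ) * (α * b - γ * a) := ⟨_, rfl⟩
      have hsq : (α * δ - β * γ) * (α * δ - β * γ) = 1 := by
        rcases hdet with h | h <;> rw [h] <;> norm_num
      have hsq' : ((α * δ - β * γ) * (α * δ - β * γ) : ℝ) = 1 := by exact_mod_cast hsq
      have hpa : a = α * p + β * q := by rw [hp, hq]; linear_combination (-a) * hsq
      have hpb : b = γ * p + δ * q := by rw [hp, hq]; linear_combination (-b) * hsq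
      have hp' : (p : ℝ) = t * l * y 0 := by
        rw [hp]; push_cast
        rw [← ha, ← hb]
        linear_combination (t * l * y 0) * hsq'
      have hq' : (q : ℝ) = t * l * y 1 := by
        rw [hq]; push_cast
        rw [← ha, ← hb]
        linear_combination (t * l * y 1) * hsq'
      by_contra! hlt
      rw [lt_div_iff₀ (by positivity)] at hlt
      have htl : 0 ≤ t * l := by positivity
      have bound : ∀ (z : ℝ) (c : ℤ), |z| ≤ 3 → (c : ℝ) = t * l * z → |c| < 2 := by
        intro z c hz hc
        have : |(c : ℝ)| < 2 := by
          rw [hc, abs_mul, abs_of_nonneg htl]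
          nlinarith [mul_le_mul_of_nonneg_left hz htl]
        exact_mod_cast this
      have b1 := bound _ (p + q) hy.1 (by push_cast; rw [hp', hq']; ring)
      have b2 := bound _ (2 * p - q) hy.2.1 (by push_cast; rw [hp', hq']; ring)
      have b3 := bound _ (2 * q - p) hy.2.2 (by push_cast; rw [hp', hq']; ring)
      rw [abs_lt] at b1 b2 b3
      obtain ⟨rfl, rfl⟩ : p = 0 ∧ q = 0 := by omega
      simp [hpa, hpb] at hab
  have h2 : 2 * l ≤ firstMinimum (polarSet (K : Set (EuclideanSpace ℝ (Fin 2)))) := by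
    refine le_firstMinimum (fun y _ => by simp) ?_ ?_
    · obtain ⟨x, -, hx0, hx1⟩ := K.exists_mem_smul_polarSet hint (m := 1) (n := 0) (by simp)
      exact ⟨_, hx0.le, 1, 0, by simp, hx1⟩
    · rintro t ht a b hab ⟨x, hx, hxab⟩
      have ha := congrArg (fun x : EuclideanSpace ℝ (Fin 2) => x 0) hxab
      have hb := congrArg (fun x : EuclideanSpace ℝ (Fin 2) => x 1) hxab
      simp at ha hb
      obtain ⟨p, hp⟩ : ∃ p : ℤ, p = U 0 0 * a + U 1 0 * b := ⟨_, rfl⟩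
      obtain ⟨q, hq⟩ : ∃ q : ℤ, q = U 0 1 * a + U 1 1 * b := ⟨_, rfl⟩
      have key : ∀ c d : ℤ, !₂[(c : ℝ), (d : ℝ)] ∈ extremalHexagon →
          l * (c * p + d * q : ℤ) ≤ t := by
        intro c d hcd
        have hm : !₂[l * (U 0 0 * c + U 0 1 * d), l * (U 1 0 * c + U 1 1 * d)] ∈
            (K : Set (EuclideanSpace ℝ (Fin 2))) := by
          rw [hK, mem_smul_unimodularImage]
          exact ⟨_, hcd, by simp, by simp⟩
        have h := mul_le_mul_of_nonneg_left (hx _ hm) ht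
        simp [PiLp.inner_apply, Fin.sum_univ_two] at h
        rw [hp, hq]
        push_cast
        rw [← ha, ← hb]
        linarith
      by_contra! hlt
      have key' : ∀ c d : ℤ, !₂[(c : ℝ), (d : ℝ)] ∈ extremalHexagon → c * p + d * q < 2 := by
        intro c d hcd
        have h := (key c d hcd).trans_lt hlt
        rw [mul_comm 2 l] at h
        exact_mod_cast lt_of_mul_lt_mul_left h hl.le
      have b1 := key' 2 1 (by rw [mem_extremalHexagon]; norm_num [abs_le])
      have b2 := key' (-2) (-1) (by rw [mem_extremalHexagon]; norm_num [abs_le])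
      have b3 := key' 1 2 (by rw [mem_extremalHexagon]; norm_num [abs_le])
      have b4 := key' (-1) (-2) (by rw [mem_extremalHexagon]; norm_num [abs_le])
      have b5 := key' (-1) 1 (by rw [mem_extremalHexagon]; norm_num [abs_le])
      have b6 := key' 1 (-1) (by rw [mem_extremalHexagon]; norm_num [abs_le])
      obtain ⟨rfl, rfl⟩ : p = 0 ∧ q = 0 := by omega
      have e1 : (U 0 0 * U 1 1 - U 0 1 * U 1 0) * a = 0 := by
        linear_combination (-(U 1 1)) * hp + U 1 0 * hq
      have e2 : (U 0 0 * U 1 1 - U 0 1 * U 1 0) * b = 0 := by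
        linear_combination (-(U 0 0)) * hq + U 0 1 * hp
      simp [hdet0] at e1 e2
      simp [e1, e2] at hab
  calc (4 / 3 : ℝ) = 2 / (3 * l) * (2 * l) := by field_simp; norm_num
    _ ≤ _ := mul_le_mul h1 h2 (by positivity) (le_trans (by positivity) h1)

end ConvexBody

theorem theorem1p4 (K : ConvexBody (EuclideanSpace ℝ (Fin 2)))
    (hsymm : -(K : Set (EuclideanSpace ℝ (Fin 2))) = K)
    (hint : (0 : EuclideanSpace ℝ (Fin 2)) ∈ interior (K : Set (EuclideanSpace ℝ (Fin 2)))) :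
    firstMinimum (K : Set (EuclideanSpace ℝ (Fin 2))) *
        firstMinimum (polarSet (K : Set (EuclideanSpace ℝ (Fin 2)))) ≤ 4 / 3 ∧
    (firstMinimum (K : Set (EuclideanSpace ℝ (Fin 2))) *
        firstMinimum (polarSet (K : Set (EuclideanSpace ℝ (Fin 2)))) = 4 / 3 ↔
      ∃ (l : ℝ) (U : GL (Fin 2) ℤ), 0 < l ∧
        (K : Set (EuclideanSpace ℝ (Fin 2))) = l • unimodularImage U extremalHexagon) := by
  -- This single implication gives both the inequality and the forward half of the equality case.
  have hmain := K.eq_smul_unimodularImage_of_four_thirds_le hsymm hint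
  refine ⟨?_, fun h => (hmain h.ge).2, ?_⟩
  · by_contra! h
    exact h.ne' (hmain h.le).1
  · rintro ⟨l, U, hl, hK⟩
    exact (hmain (K.four_thirds_le_of_eq_smul_unimodularImage hint hl hK)).1
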